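/- Let $\mathbb T^2=(\mathbb R/2\pi\mathbb Z)^2$ and write $\hat f(k)=(2\pi)^{-2}\int_{\mathbb T^2}f(x)e^{-ik\cdot x}\,dx$, $k\in\mathbb Z^2$. All functions are real-valued with mean zero over $\mathbb T^2$. Consider the singular incompressible porous media equation $$\partial_t\theta+u\cdot\nabla\theta=0,\qquad u=(-\Delta)^{\alpha/2}\mathbf I\theta,\qquad \theta(\cdot,0)=\theta_0\qquad\text{on }\mathbb T^2,$$ where $\mathbf I=(\mathbf I_1,\mathbf I_2)$ is the Fourier multiplier with $\hat{\mathbf I}(k)=\big(-\tfrac{k_1k_2}{|k|^2},\tfrac{k_1^2}{|k|^2}\big)$ for $k\neq0$ and $\hat{\mathbf I}(0)=(0,0)$. For fixed $r>3$ and for $s,\tau>0$ let $G^s_\tau$ be the space of functions with $$\|f\|_{G^s_\tau}^2=\sum_{k\ne0}|k|^{2r}e^{2\tau|k|^{1/s}}|\hat f(k)|^2<\infty,$$ and let $\|f\|_{H^q}^2=\sum_k(1+|k|^2)^q|\hat f(k)|^2$. The equation is called locally Lipschitz $(H^q,G^s_\tau)$ well-posed if there are continuous functions $T,K:[0,\infty)^2\to(0,\infty)$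 such that for all $\theta_0^{(1)},\theta_0^{(2)}\in G^s_\tau$, with $T$ and $K$ evaluated at $(\|\theta_0^{(1)}\|_{G^s_\tau},\|\theta_0^{(2)}\|_{G^s_\tau})$, there exist unique weak solutions $\theta^{(1)},\theta^{(2)}\in L^\infty(0,T;H^q)$ with these initial data (each taken as its representative in $C([0,T];L^2)$), and $$\|\theta^{(1)}(t)-\theta^{(2)}(t)\|_{H^q}\le K\,\|\theta_0^{(1)}-\theta_0^{(2)}\|_{G^s_\tau}\qquad\text{for every }t\in[0,T].$$ Otherwise it is called locally Lipschitz $(H^q,G^s_\tau)$ ill-posed. **Theorem.** Let $\alpha\in[1,2)$, $q>\alpha+\tfrac12$, $s>\tfrac1\alpha$ and $r>3$. Then for every $\tau>0$ the singular incompressible porous media equation above is locally Lipschitz $(H^q,G^s_\tau)$ ill-posed. -/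

import Mathlib

open scoped ENNReal NNReal ContDiff

noncomputable section

namespace SIPM

instance instTwoPiPos : Fact (0 < 2 * Real.pi) := ⟨Real.two_pi_pos⟩

/-- The torus `𝕋² = (ℝ / 2πℤ)²`, with its Lebesgue measure (of total mass `(2π)²`). -/
abbrev Torus : Type := Fin 2 → AddCircle (2 * Real.pi)

/-- The real Hilbert space `L²(𝕋²; ℝ)`. -/
abbrev L2 : Type := MeasureTheory.Lp ℝ 2 (MeasureTheory.volume : MeasureTheory.Measure Torus)

/-- The character `x ↦ exp (i k · x)` of the torus. -/
def character (k : Fin 2 → ℤ) (x : Torus) : ℂ := ∏ i, fourier (k i) (x i)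

/-- The Fourier coefficient `(2π)⁻² ∫ f(x) exp (-i k · x) dx`. -/
def coeff (f : L2) (k : Fin 2 → ℤ) : ℂ :=
  ((2 * Real.pi : ℝ) : ℂ)⁻¹ ^ 2 * ∫ x : Torus, (f x : ℂ) * character (-k) x

/-- The Euclidean length `|k|` of a frequency `k ∈ ℤ²`. -/
def freqNorm (k : Fin 2 → ℤ) : ℝ := Real.sqrt ((k 0 : ℝ) ^ 2 + (k 1 : ℝ) ^ 2)

/-- `f` has mean zero. -/
def MeanFree (f : L2) : Prop := ∫ x : Torus, f x = 0

/-- The inhomogeneous Sobolev norm of `H^q(𝕋²)`; its value is `∞` exactly when `f ∉ H^q`. -/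
def sobolevNorm (q : ℝ) (f : L2) : ℝ≥0∞ :=
  (∑' k : Fin 2 → ℤ, ENNReal.ofReal ((1 + freqNorm k ^ 2) ^ q * ‖coeff f k‖ ^ 2)) ^ (1 / 2 : ℝ)

/-- The Gevrey norm `‖(-Δ)^{r/2} exp (τ (-Δ)^{1/(2s)}) f‖_{L²}`, a sum over nonzero frequencies;
its value is `∞` exactly when a mean-free `f` does not lie in `G^s_τ`. -/
def gevreyNorm (r s τ : ℝ) (f : L2) : ℝ≥0∞ :=
  (∑' k : {k : Fin 2 → ℤ // k ≠ 0},
    ENNReal.ofReal (freqNorm k ^ (2 * r) * Real.exp (2 * τ * freqNorm k ^ (1 / s))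
      * ‖coeff f k‖ ^ 2)) ^ (1 / 2 : ℝ)

/-- `f` belongs to the space `G^s_τ` of mean-free functions with finite Gevrey norm. -/
def MemGevrey (r s τ : ℝ) (f : L2) : Prop := MeanFree f ∧ gevreyNorm r s τ f < ⊤

/-- `g = m(D) f`: both are in `L²` and `ĝ(k) = m(k) f̂(k)` for every frequency `k`. -/
def IsMultiplierImage (m : (Fin 2 → ℤ) → ℂ) (f g : L2) : Prop :=
  ∀ k, coeff g k = m k * coeff f k

/-- The symbol `(-k₁k₂ / |k|², k₁² / |k|²)` of the operator `I`; at `k = 0` it is `(0, 0)`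
(division by zero gives zero). -/
def symbolI (k : Fin 2 → ℤ) : Fin 2 → ℝ :=
  ![-((k 0 : ℝ) * (k 1 : ℝ)) / ((k 0 : ℝ) ^ 2 + (k 1 : ℝ) ^ 2),
    (k 0 : ℝ) ^ 2 / ((k 0 : ℝ) ^ 2 + (k 1 : ℝ) ^ 2)]

/-- `u = (-Δ)^{α/2} I θ`. -/
def IsVelocity (α : ℝ) (θ : L2) (u : Fin 2 → L2) : Prop :=
  ∀ i, IsMultiplierImage (fun k => ((freqNorm k ^ α * symbolI k i : ℝ) : ℂ)) θ (u i)

/-- `g = ∇θ`, as a Fourier multiplier. -/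
def IsGradient (θ : L2) (g : Fin 2 → L2) : Prop :=
  ∀ i, IsMultiplierImage (fun k => Complex.I * (k i : ℂ)) θ (g i)

/-- `φ` is a smooth function on the torus, i.e. its periodic lift to `ℝ²` is smooth. -/
def SmoothOnTorus (φ : Torus → ℝ) : Prop :=
  ContDiff ℝ ∞ fun x : Fin 2 → ℝ => φ fun i => (x i : AddCircle (2 * Real.pi))

/-- `θ` is a (mean-free) solution on `[0, T]`, in the class `L^∞(0, T; H^q)`, of
`∂ₜθ + u · ∇θ = 0`, `u = (-Δ)^{α/2} I θ`, `θ(0) = θ₀`.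

The equation is understood weakly (tested against smooth functions of `x`, integrated in time).
For such `θ` the time derivative is bounded with values in `L²`, so that `θ` has a representative
that is continuous in time with values in `L²`, and for this representative the essential bound
of the `H^q` norm holds at every time; `θ` always denotes this representative. -/
structure IsSolution (α q T : ℝ) (θ₀ : L2) (θ : ℝ → L2) : Prop where
  continuousOn : ContinuousOn θ (Set.Icc 0 T)
  bounded : ∃ M : ℝ≥0, ∀ t ∈ Set.Icc 0 T, sobolevNorm q (θ t) ≤ M
  meanFree : ∀ t ∈ Set.Icc 0 T, MeanFree (θ t)
  initial : θ 0 = θ₀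
  equation : ∃ u g : ℝ → Fin 2 → L2,
    (∀ t ∈ Set.Icc 0 T, IsVelocity α (θ t) (u t) ∧ IsGradient (θ t) (g t)) ∧
    ∀ φ : Torus → ℝ, SmoothOnTorus φ → ∀ t ∈ Set.Icc 0 T,
      (∫ x : Torus, θ t x * φ x) - (∫ x : Torus, θ₀ x * φ x)
        = -∫ t' in (0 : ℝ)..t, ∫ x : Torus, (∑ i, u t' i x * g t' i x) * φ x

/-- `θ` is the only solution on `[0, T]` in the class `L^∞(0, T; H^q)` with data `θ₀`. -/
def IsUniqueSolution (α q T : ℝ) (θ₀ : L2) (θ : ℝ → L2) : Prop :=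
  IsSolution α q T θ₀ θ ∧
    ∀ θ' : ℝ → L2, IsSolution α q T θ₀ θ' → Set.EqOn θ' θ (Set.Icc 0 T)

/-- Local Lipschitz `(H^q, G^s_τ)` well-posedness: there are continuous functions
`T, K : [0, ∞)² → (0, ∞)` such that any two data in `G^s_τ` launch unique solutions in
`L^∞(0, T; H^q)`, and `‖θ₁(t) - θ₂(t)‖_{H^q} ≤ K ‖θ₁(0) - θ₂(0)‖_{G^s_τ}` on `[0, T]`, where `T`
and `K` are evaluated at the Gevrey norms of the two data. -/
def LocallyLipschitzWellPosed (α q r s τ : ℝ) : Prop :=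
  ∃ T K : ℝ≥0 × ℝ≥0 → ℝ, Continuous T ∧ Continuous K ∧ (∀ p, 0 < T p) ∧ (∀ p, 0 < K p) ∧
    ∀ θ₀₁ θ₀₂ : L2, MemGevrey r s τ θ₀₁ → MemGevrey r s τ θ₀₂ →
      let p : ℝ≥0 × ℝ≥0 := ((gevreyNorm r s τ θ₀₁).toNNReal, (gevreyNorm r s τ θ₀₂).toNNReal)
      ∃ θ₁ θ₂ : ℝ → L2,
        IsUniqueSolution α q (T p) θ₀₁ θ₁ ∧ IsUniqueSolution α q (T p) θ₀₂ θ₂ ∧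
        ∀ t ∈ Set.Icc 0 (T p),
          sobolevNorm q (θ₁ t - θ₂ t) ≤ ENNReal.ofReal (K p) * gevreyNorm r s τ (θ₀₁ - θ₀₂)

/-- Local Lipschitz `(H^q, G^s_τ)` ill-posedness is the failure of well-posedness. -/
def LocallyLipschitzIllPosed (α q r s τ : ℝ) : Prop := ¬ LocallyLipschitzWellPosed α q r s τ

end SIPM

end

noncomputable section

namespace SIPM

section

open MeasureTheory Set Submodule
open scoped ComplexConjugate

/-! ### Fourier series on the torus -/

/-! The shear `-2 sin x₂` is stationary, because the velocity symbol vanishes on `k 0 = 0`, but it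
is violently unstable. Write a solution as shear plus `ρ`, with velocity `u`. Then `∂ₜρ = 2 cos x₂ ·
u₂ - u · ∇ρ`. Multiplication by `2 cos x₂` shifts the second frequency by `±1`, and the symbol of
`u₂` is real and nonnegative. The real parts `z j` of the coefficients at `(n, j)` therefore satisfy
`z j' = b (j-1) z (j-1) + b (j+1) z (j+1) + e j` with `b ≥ 0`, up to a quadratic remainder `e`.

Since `b 0` and `b 1` are at least `n^α / 2`, a comparison principle
(`neighbour_coupling_lower_bound`) makes the datum `2ε cos (n x₁)` grow at least like `ε cosh (n^α t
/ 2)`, minus the effect of `e` (`IsSolution.growth`). A Lipschitz estimate would bound `ρ` in `H^q`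
by `K` times the Gevrey size of the perturbation, of order `ε n^r exp (τ n^(1/s))`. As `1/s < α`, a
large `n` makes the growth exceed this bound. With `n` fixed, the same estimate makes the remainder
`O(ε²)`, so a small `ε` renders it harmless, however large its constant in `n`.

The remaining work is Fourier analysis: Parseval, and the fact that velocity and gradient have order
at most `α < q`, hence are bounded and continuous in time with values in `L²`. -/

lemma character_neg (k : Fin 2 → ℤ) (x : Torus) : character (-k) x = conj (character k x) := by
  simp only [character, Pi.neg_apply, fourier_neg, map_prod]

lemma character_add (k l : Fin 2 → ℤ) (x : Torus) :
    character (k + l) x = character k x * character l x := by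
  simp only [character, Pi.add_apply, fourier_add, ← Finset.prod_mul_distrib]

lemma character_zero (x : Torus) : character 0 x = 1 := by
  simp [character]

lemma norm_character (k : Fin 2 → ℤ) (x : Torus) : ‖character k x‖ = 1 := by
  simp [character, fourier_apply, Circle.norm_coe]

lemma continuous_character (k : Fin 2 → ℤ) : Continuous (character k) := by
  unfold character
  fun_prop

/-- The character of frequency `k`, as a continuous map. -/
def characterMap (k : Fin 2 → ℤ) : C(Torus, ℂ) := ⟨character k, continuous_character k⟩

lemma integral_character (k : Fin 2 → ℤ) :
    ∫ x : Torus, character k x = if k = 0 then ((2 * Real.pi : ℝ) : ℂ) ^ 2 else 0 := by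
  have h1 : ∀ n : ℤ, ∫ x : AddCircle (2 * Real.pi), fourier n x
      = if n = 0 then ((2 * Real.pi : ℝ) : ℂ) else 0 := by
    intro n
    have h := (orthonormal_iff_ite.mp (orthonormal_fourier (T := 2 * Real.pi))) 0 n
    rw [ContinuousMap.inner_toLp] at h
    simp only [← fourier_neg, ← fourier_add, neg_zero, add_zero] at h
    rw [AddCircle.volume_eq_smul_haarAddCircle, integral_smul_measure, h,
      ENNReal.toReal_ofReal Real.two_pi_pos.le]
    by_cases hn : n = 0
    · simp [hn]
    · simp [hn, Ne.symm hn]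
  unfold character
  rw [MeasureTheory.integral_fintype_prod_volume_eq_prod (fun i x => fourier (k i) x)]
  simp only [h1, Fin.prod_univ_two]
  by_cases hk : k = 0
  · simp [hk, sq]
  · rw [if_neg hk]
    have : k 0 ≠ 0 ∨ k 1 ≠ 0 := by
      by_contra! h
      exact hk (funext fun i => by fin_cases i <;> simp [h])
    rcases this with h | h <;> simp [h]

/-- The star subalgebra of trigonometric polynomials. -/
def trigSubalgebra : StarSubalgebra ℂ C(Torus, ℂ) where
  toSubalgebra := Algebra.adjoin ℂ (range characterMap)
  star_mem' := by
    change Algebra.adjoin ℂ (range characterMap) ≤ star (Algebra.adjoin ℂ (range characterMap))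
    refine Algebra.adjoin_le ?_
    rintro _ ⟨n, rfl⟩
    refine Algebra.subset_adjoin ⟨-n, ?_⟩
    ext1 x
    simp [characterMap, character_neg]

lemma trigSubalgebra_coe :
    trigSubalgebra.toSubalgebra.toSubmodule = span ℂ (range characterMap) := by
  apply Algebra.adjoin_eq_span_of_subset
  refine .trans (fun x ↦ Submonoid.closure_induction (fun _ ↦ id) ⟨0, ?_⟩ ?_) subset_span
  · ext z
    simp [characterMap, character_zero]
  · rintro _ _ _ _ ⟨m, rfl⟩ ⟨n, rfl⟩
    refine ⟨m + n, ?_⟩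
    ext z
    simp [characterMap, character_add]

lemma character_single (z : Torus) (i : Fin 2) :
    character (Pi.single i 1) z = fourier 1 (z i) := by
  fin_cases i <;> simp [character]

lemma trigSubalgebra_separatesPoints : trigSubalgebra.SeparatesPoints := by
  intro x y hxy
  rw [Ne, funext_iff, not_forall] at hxy
  obtain ⟨i, hi⟩ := hxy
  refine ⟨_, ⟨characterMap (Pi.single i 1), Algebra.subset_adjoin ⟨Pi.single i 1, rfl⟩, rfl⟩, ?_⟩
  change character _ x ≠ character _ y
  rw [character_single, character_single, fourier_one, fourier_one]
  exact fun h => hi (AddCircle.injective_toCircle Real.two_pi_pos.ne' (Circle.ext h))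

/-- Stone–Weierstrass; point separation comes from the two coordinate characters. -/
lemma span_characterMap_closure_eq_top :
    (span ℂ (range characterMap)).topologicalClosure = ⊤ := by
  rw [← trigSubalgebra_coe]
  exact congr_arg (Subalgebra.toSubmodule <| StarSubalgebra.toSubalgebra ·)
    (ContinuousMap.starSubalgebra_topologicalClosure_eq_top_of_separatesPoints _
      trigSubalgebra_separatesPoints)

/-- The normalised characters, as elements of the complex `L²` space of the torus. -/
def characterLp (k : Fin 2 → ℤ) : Lp ℂ 2 (volume : Measure Torus) :=
  ((2 * Real.pi : ℝ) : ℂ)⁻¹ • ContinuousMap.toLp (E := ℂ) 2 volume ℂ (characterMap k)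

lemma two_pi_ne_zero_complex : ((2 * Real.pi : ℝ) : ℂ) ≠ 0 :=
  Complex.ofReal_ne_zero.mpr Real.two_pi_pos.ne'

lemma span_characterLp_closure_eq_top :
    (span ℂ (range characterLp)).topologicalClosure = ⊤ := by
  have h1 : (span ℂ (range fun k => ContinuousMap.toLp (E := ℂ) 2 (volume : Measure Torus) ℂ
      (characterMap k))).topologicalClosure = ⊤ := by
    simpa only [map_span, ContinuousLinearMap.coe_coe, ← range_comp, Function.comp_def] using
      (ContinuousMap.toLp_denseRange ℂ (volume : Measure Torus) ℂ
        (p := 2) (by simp)).topologicalClosure_map_submodule span_characterMap_closure_eq_top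
  rw [eq_top_iff, ← h1]
  refine Submodule.topologicalClosure_mono (span_le.mpr ?_)
  rintro _ ⟨k, rfl⟩
  have : ContinuousMap.toLp (E := ℂ) 2 (volume : Measure Torus) ℂ (characterMap k)
      = ((2 * Real.pi : ℝ) : ℂ) • characterLp k := by
    rw [characterLp, smul_smul, mul_inv_cancel₀ two_pi_ne_zero_complex, one_smul]
  simp only [SetLike.mem_coe]
  rw [this]
  exact smul_mem _ _ (subset_span ⟨k, rfl⟩)

lemma orthonormal_characterLp : Orthonormal ℂ characterLp := by
  rw [orthonormal_iff_ite]
  intro m n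
  simp only [characterLp, inner_smul_left, inner_smul_right, ContinuousMap.inner_toLp]
  have : ∀ x, (characterMap n) x * (starRingEnd ℂ) ((characterMap m) x)
      = character (n + -m) x := fun x => by
    rw [character_add, character_neg]; rfl
  simp only [this, integral_character, ← sub_eq_add_neg, sub_eq_zero]
  have := two_pi_ne_zero_complex
  by_cases h : m = n
  · rw [if_pos h, if_pos h.symm, ← Complex.ofReal_inv, Complex.conj_ofReal, Complex.ofReal_inv]
    field_simp
  · rw [if_neg h, if_neg (Ne.symm h)]; simp

/-- The Hilbert basis of normalised characters. -/
def characterBasis : HilbertBasis (Fin 2 → ℤ) ℂ (Lp ℂ 2 (volume : Measure Torus)) :=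
  HilbertBasis.mk orthonormal_characterLp span_characterLp_closure_eq_top.ge

/-- The basis vectors carry a factor `(2π)⁻¹` and `coeff` carries `(2π)⁻²`, which leaves one factor
`2π`. -/
lemma characterBasis_repr (f : L2) (k : Fin 2 → ℤ) :
    characterBasis.repr (Complex.ofRealCLM.compLp f) k = ((2 * Real.pi : ℝ) : ℂ) * coeff f k := by
  rw [characterBasis.repr_apply_apply, characterBasis, HilbertBasis.coe_mk, characterLp,
    inner_smul_left, MeasureTheory.L2.inner_def, coeff, ← Complex.ofReal_inv, Complex.conj_ofReal,
    Complex.ofReal_inv, ← mul_assoc]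
  congr 1
  · have := two_pi_ne_zero_complex
    field_simp
  · apply integral_congr_ae
    filter_upwards [ContinuousMap.coeFn_toLp (𝕜 := ℂ) (p := 2) (volume : Measure Torus)
      (characterMap k), Complex.ofRealCLM.coeFn_compLp f] with x h1 h2
    rw [h1, h2, RCLike.inner_apply, character_neg]
    rfl

/-- **Parseval's identity**. -/
lemma hasSum_sq_coeff (f : L2) :
    HasSum (fun k => ‖coeff f k‖ ^ 2) ((2 * Real.pi)⁻¹ ^ 2 * ‖f‖ ^ 2) := by
  set F : Lp ℂ 2 (volume : Measure Torus) := Complex.ofRealCLM.compLp f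
  have hn : ‖F‖ = ‖f‖ := by
    rw [Lp.norm_def, Lp.norm_def]
    congr 1
    apply eLpNorm_congr_norm_ae
    filter_upwards [Complex.ofRealCLM.coeFn_compLp f] with x h
    rw [h]; simp
  have h := RCLike.hasSum_re ℂ (characterBasis.hasSum_inner_mul_inner F F)
  rw [inner_self_eq_norm_sq, hn] at h
  have h2 : ∀ k, RCLike.re (inner ℂ F (characterBasis k) * inner ℂ (characterBasis k) F)
      = (2 * Real.pi) ^ 2 * ‖coeff f k‖ ^ 2 := by
    intro k
    rw [← inner_conj_symm, ← characterBasis.repr_apply_apply, characterBasis_repr,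
      RCLike.conj_mul, norm_mul, Complex.norm_real, Real.norm_of_nonneg Real.two_pi_pos.le]
    norm_cast
    rw [mul_pow]
  simp only [h2] at h
  have h3 := h.mul_left ((2 * Real.pi)⁻¹ ^ 2)
  have hc : (2 * Real.pi)⁻¹ ^ 2 * (2 * Real.pi) ^ 2 = 1 := by
    rw [← mul_pow, inv_mul_cancel₀ Real.two_pi_pos.ne', one_pow]
  simpa only [← mul_assoc, hc, one_mul] using h3

lemma integrable_mul_character (f : L2) (k : Fin 2 → ℤ) :
    Integrable (fun x : Torus => (f x : ℂ) * character k x) := by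
  have hf : Integrable (fun x => (f x : ℂ)) :=
    (((Lp.memLp f).integrable (by norm_num)) : Integrable f volume).ofReal
  refine hf.mul_bdd (c := 1) (continuous_character k).aestronglyMeasurable ?_
  exact ae_of_all _ fun x => (norm_character k x).le

lemma coeff_sub (f g : L2) (k : Fin 2 → ℤ) : coeff (f - g) k = coeff f k - coeff g k := by
  unfold coeff
  rw [← mul_sub, ← integral_sub (integrable_mul_character f _) (integrable_mul_character g _)]
  congr 1
  apply integral_congr_ae
  filter_upwards [Lp.coeFn_sub f g] with x h
  rw [h, Pi.sub_apply, Complex.ofReal_sub, sub_mul]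

lemma coeff_zero (k : Fin 2 → ℤ) : coeff 0 k = 0 := by
  simpa using coeff_sub 0 0 k

lemma coeff_neg (f : L2) (k : Fin 2 → ℤ) : coeff (-f) k = -coeff f k := by
  simpa [coeff_zero] using coeff_sub 0 f k

lemma coeff_add (f g : L2) (k : Fin 2 → ℤ) : coeff (f + g) k = coeff f k + coeff g k := by
  simpa [coeff_neg] using coeff_sub f (-g) k

/-- The cosine `x ↦ cos (k · x)`. -/
def cosine (k : Fin 2 → ℤ) (x : Torus) : ℝ := (character k x).re

lemma re_coeff (f : L2) (k : Fin 2 → ℤ) :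
    (coeff f k).re = (2 * Real.pi)⁻¹ ^ 2 * ∫ x : Torus, f x * cosine k x := by
  rw [coeff, ← Complex.ofReal_inv, ← Complex.ofReal_pow, Complex.re_ofReal_mul]
  congr 1
  have := integral_re (integrable_mul_character f (-k))
  simp only [RCLike.re_eq_complex_re] at this
  rw [← this]
  refine integral_congr_ae (ae_of_all _ fun x => ?_)
  simp [character_neg, cosine]

/-- Turns the weak equation tested against a cosine into an equation for the real part of one
Fourier coefficient. -/
lemma integral_mul_cosine (f : L2) (k : Fin 2 → ℤ) :
    ∫ x : Torus, f x * cosine k x = (2 * Real.pi) ^ 2 * (coeff f k).re := by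
  have := Real.two_pi_pos.ne'
  rw [re_coeff]
  field_simp

lemma continuous_cosine (k : Fin 2 → ℤ) : Continuous (cosine k) :=
  Complex.continuous_re.comp (continuous_character k)

lemma abs_cosine_le (k : Fin 2 → ℤ) (x : Torus) : |cosine k x| ≤ 1 :=
  (Complex.abs_re_le_norm _).trans (norm_character k x).le

lemma smoothOnTorus_cosine (k : Fin 2 → ℤ) : SmoothOnTorus (cosine k) := by
  unfold SmoothOnTorus cosine character
  simp only [fourier_coe_apply, Fin.prod_univ_two]
  have h : ∀ i : Fin 2, ContDiff ℝ ∞ fun x : Fin 2 → ℝ => (x i : ℂ) := fun i =>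
    ContDiff.comp (g := Complex.ofRealCLM) (ContinuousLinearMap.contDiff _) (contDiff_apply ℝ ℝ i)
  have h0 := h 0
  have h1 := h 1
  have h2 : ContDiff ℝ ∞ (fun z : ℂ => z.re) := Complex.reCLM.contDiff
  refine h2.comp ?_
  fun_prop

lemma integrable_mul_cosine (f : L2) (k : Fin 2 → ℤ) :
    Integrable (fun x : Torus => f x * cosine k x) := by
  have hf : Integrable f volume := (Lp.memLp f).integrable (by norm_num)
  refine hf.mul_bdd (c := 1) (continuous_cosine k).aestronglyMeasurable ?_
  exact ae_of_all _ fun x => abs_cosine_le k x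

/-- Source of the neighbour coupling: multiplying by a cosine shifts frequencies both ways. -/
lemma cosine_mul_cosine (k l : Fin 2 → ℤ) (x : Torus) :
    2 * cosine k x * cosine l x = cosine (l + k) x + cosine (l - k) x := by
  simp only [cosine, sub_eq_add_neg, character_add, character_neg, Complex.mul_re, Complex.conj_re,
    Complex.conj_im]
  ring

/-! ### Trigonometric monomials as elements of `L²` -/

/-- The real part of `z exp (i k · x)`, as an element of `L²`. -/
def mode (z : ℂ) (k : Fin 2 → ℤ) : L2 :=
  ContinuousMap.toLp (E := ℝ) 2 volume ℝ
    ⟨fun x => (z * character k x).re,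
      Complex.continuous_re.comp (continuous_const.mul (continuous_character k))⟩

lemma coeFn_mode (z : ℂ) (k : Fin 2 → ℤ) :
    mode z k =ᵐ[volume] fun x => (z * character k x).re :=
  ContinuousMap.coeFn_toLp (𝕜 := ℝ) (p := 2) (volume : Measure Torus) _

lemma coeff_mode (z : ℂ) (k l : Fin 2 → ℤ) :
    coeff (mode z k) l = ((if l = k then z else 0) + if l = -k then conj z else 0) / 2 := by
  have h : ∫ x : Torus, (mode z k x : ℂ) * character (-l) x
      = ∫ x : Torus, (z / 2 * character (k - l) x + conj z / 2 * character (-k - l) x) := by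
    apply integral_congr_ae
    filter_upwards [coeFn_mode z k] with x h
    rw [h, Complex.re_eq_add_conj, sub_eq_add_neg, sub_eq_add_neg, character_add, character_add,
      character_neg k, map_mul]
    ring
  have hi : ∀ (c : ℂ) (m : Fin 2 → ℤ), Integrable fun x : Torus => c * character m x := fun c m =>
    ((continuous_const.mul (continuous_character m)).integrable_of_hasCompactSupport
      (HasCompactSupport.of_compactSpace _))
  rw [coeff, h, integral_add (hi _ _) (hi _ _), integral_const_mul, integral_const_mul,
    integral_character, integral_character]
  have := two_pi_ne_zero_complex
  simp only [sub_eq_zero, eq_comm (a := l)]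
  generalize ((2 * Real.pi : ℝ) : ℂ) = c at this ⊢
  split_ifs <;> field_simp <;> ring

end

section

open MeasureTheory Set Filter Topology

/-! ### A comparison principle and a growth estimate -/

/-- Lower bound for a solution of a perturbed infinite system of ordinary differential equations
with nonnegative coefficients coupling neighbouring components. -/
lemma neighbour_coupling_lower_bound {T B Z ε E l : ℝ} {b : ℤ → ℝ} {z e : ℤ → ℝ → ℝ}
    (hT : 0 ≤ T) (hB : 0 ≤ B) (hε : 0 ≤ ε) (hE : 0 ≤ E) (hl : 0 ≤ l)
    (hb0 : ∀ j, 0 ≤ b j) (hbB : ∀ j, b j ≤ B) (hl0 : l ≤ b 0) (hl1 : l ≤ b 1)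
    (hz : ∀ j, ∀ t ∈ Icc 0 T, |z j t| ≤ Z)
    (hzc : ∀ j, ContinuousOn (z j) (Icc 0 T))
    (he : ∀ j, ContinuousOn (e j) (Icc 0 T))
    (heE : ∀ j, ∀ t ∈ Icc 0 T, |e j t| ≤ E)
    (heq : ∀ j, ∀ t ∈ Icc 0 T, z j t = ε * (if j = 0 then 1 else 0)
      + ∫ x in (0 : ℝ)..t, (b (j - 1) * z (j - 1) x + b (j + 1) * z (j + 1) x + e j x)) :
    ε * Real.cosh (l * T) - E * T * Real.exp (2 * B * T) ≤ z 0 T := by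
  -- A subsolution: the exact solution of the two-component system on `j = 0, 1` with both
  -- coefficients lowered to `l`, extended by zero.
  let p : ℤ → ℝ → ℝ := fun j t =>
    if j = 0 then ε * Real.cosh (l * t) else if j = 1 then ε * Real.sinh (l * t) else 0
  let dp : ℤ → ℝ → ℝ := fun j t =>
    if j = 0 then ε * (Real.sinh (l * t) * l) else
      if j = 1 then ε * (Real.cosh (l * t) * l) else 0
  have hpd : ∀ j t, HasDerivAt (p j) (dp j t) t := by
    intro j t
    have hlin : HasDerivAt (fun t : ℝ => l * t) l t := by
      simpa using (hasDerivAt_id t).const_mul l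
    simp only [p, dp]
    split_ifs
    · exact hlin.cosh.const_mul ε
    · exact hlin.sinh.const_mul ε
    · exact hasDerivAt_const t 0
  have hdpc : ∀ j, Continuous (dp j) := by
    intro j
    simp only [dp]
    split_ifs <;> fun_prop
  have hp0 : ∀ j, ∀ t, 0 ≤ t → 0 ≤ p j t := by
    intro j t ht
    simp only [p]
    have : 0 ≤ Real.sinh (l * t) := Real.sinh_nonneg_iff.mpr (mul_nonneg hl ht)
    have := (Real.cosh_pos (l * t)).le
    split_ifs <;> positivity
  have hpY : ∀ j, ∀ t ∈ Icc 0 T, p j t ≤ ε * Real.cosh (l * T) := by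
    intro j t ht
    have h1 : Real.cosh (l * t) ≤ Real.cosh (l * T) := by
      rw [Real.cosh_le_cosh, abs_of_nonneg (mul_nonneg hl ht.1), abs_of_nonneg (mul_nonneg hl hT)]
      exact mul_le_mul_of_nonneg_left ht.2 hl
    have h2 := (Real.sinh_lt_cosh (l * t)).le
    have h3 := (Real.cosh_pos (l * T)).le
    simp only [p]
    split_ifs
    · gcongr
    · gcongr; exact h2.trans h1
    · positivity
  have hdp : ∀ j t, 0 ≤ t → dp j t ≤ b (j - 1) * p (j - 1) t + b (j + 1) * p (j + 1) t := by
    intro j t ht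
    have hm := mul_nonneg (hb0 (j - 1)) (hp0 (j - 1) t ht)
    have hp := mul_nonneg (hb0 (j + 1)) (hp0 (j + 1) t ht)
    by_cases h0 : j = 0
    · subst h0
      have hs : 0 ≤ ε * Real.sinh (l * t) :=
        mul_nonneg hε (Real.sinh_nonneg_iff.mpr (mul_nonneg hl ht))
      have : dp 0 t ≤ b (0 + 1) * p (0 + 1) t := by
        simp only [dp, p, if_true, zero_add, one_ne_zero, if_false]
        nlinarith
      linarith
    · by_cases h1 : j = 1
      · subst h1
        have hs : 0 ≤ ε * Real.cosh (l * t) := mul_nonneg hε (Real.cosh_pos _).le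
        have : dp 1 t ≤ b (1 - 1) * p (1 - 1) t := by
          simp only [dp, p, if_true, sub_self, one_ne_zero, if_false]
          nlinarith
        linarith
      · simp only [dp, h0, h1, if_false]
        linarith
  set Y := Z + ε * Real.cosh (l * T) with hY
  have hZ0 : 0 ≤ Z := (abs_nonneg _).trans (hz 0 0 ⟨le_rfl, hT⟩)
  have hY0 : 0 ≤ Y := add_nonneg hZ0 (mul_nonneg hε (Real.cosh_pos _).le)
  -- Picard iteration from the crude bound `Y`. Each pass through the integral equation replaces the
  -- deficit by at most `2B` times its time integral, uniformly in `j`, which produces `(2Bt)^m /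
  -- m!`.
  have key : ∀ m : ℕ, ∀ j, ∀ t ∈ Icc 0 T,
      p j t - E * t * Real.exp (2 * B * t) - Y * ((2 * B * t) ^ m / m.factorial) ≤ z j t := by
    intro m
    induction m with
    | zero =>
      intro j t ht
      have h1 := hpY j t ht
      have h2 := (abs_le.mp (hz j t ht)).1
      have h3 : 0 ≤ E * t * Real.exp (2 * B * t) :=
        mul_nonneg (mul_nonneg hE ht.1) (Real.exp_pos _).le
      simp only [pow_zero, Nat.factorial_zero, Nat.cast_one, div_one, mul_one]
      linarith
    | succ m ih =>
      intro j t ht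
      let L : ℝ → ℝ := fun t =>
        p j t - E * t * Real.exp (2 * B * t) - Y * ((2 * B * t) ^ (m + 1) / (m + 1).factorial)
      let dL : ℝ → ℝ := fun t =>
        dp j t - (E * Real.exp (2 * B * t) + E * t * (Real.exp (2 * B * t) * (2 * B)))
          - Y * (2 * B * ((2 * B * t) ^ m / m.factorial))
      have hL : ∀ x, HasDerivAt L (dL x) x := by
        intro x
        have hlin : HasDerivAt (fun t : ℝ => 2 * B * t) (2 * B) x := by
          simpa using (hasDerivAt_id x).const_mul (2 * B)
        have hE1 : HasDerivAt (fun t : ℝ => E * t) E x := by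
          simpa using (hasDerivAt_id x).const_mul E
        refine ((hpd j x).sub (hE1.mul hlin.exp)).sub
          ((((hlin.pow (m + 1)).div_const _).const_mul Y).congr_deriv ?_)
        have : ((m + 1).factorial : ℝ) = (m + 1) * m.factorial := by
          rw [Nat.factorial_succ]; push_cast; ring
        rw [this]
        have : (m.factorial : ℝ) ≠ 0 := by positivity
        have : (m + 1 : ℝ) ≠ 0 := by positivity
        push_cast
        field_simp
      have hdLc : Continuous dL := by
        have := hdpc j
        fun_prop
      have hL0 : L 0 = ε * (if j = 0 then 1 else 0) := by
        simp only [L, p]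
        split_ifs <;> simp
      have hint : ∫ x in (0 : ℝ)..t, dL x = L t - L 0 :=
        intervalIntegral.integral_eq_sub_of_hasDerivAt (fun x _ => hL x)
          (hdLc.intervalIntegrable _ _)
      rw [heq j t ht]
      change L t ≤ _
      have hsub : Icc 0 t ⊆ Icc 0 T := Icc_subset_Icc_right ht.2
      have hmono : ∫ x in (0 : ℝ)..t, dL x
          ≤ ∫ x in (0 : ℝ)..t, (b (j - 1) * z (j - 1) x + b (j + 1) * z (j + 1) x + e j x) := by
        refine intervalIntegral.integral_mono_on ht.1 (hdLc.intervalIntegrable _ _) ?_ ?_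
        · refine ContinuousOn.intervalIntegrable_of_Icc ht.1 ?_
          exact (((continuousOn_const.mul (hzc (j - 1))).add
            (continuousOn_const.mul (hzc (j + 1)))).add (he j)).mono hsub
        · intro x hx
          have hxT := hsub hx
          have h1 := hdp j x hx.1
          have h2 := (abs_le.mp (heE j x hxT)).1
          set κ := E * x * Real.exp (2 * B * x)
          set h := Y * ((2 * B * x) ^ m / m.factorial)
          have hκ : 0 ≤ κ := mul_nonneg (mul_nonneg hE hx.1) (Real.exp_pos _).le
          have hh : 0 ≤ h := by have := hx.1; positivity
          have h3 : ∀ i, b i * p i x - B * (κ + h) ≤ b i * z i x := by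
            intro i
            have := mul_le_mul_of_nonneg_left (ih i x hxT) (hb0 i)
            have := mul_le_mul_of_nonneg_right (hbB i) (add_nonneg hκ hh)
            nlinarith
          have h4 := h3 (j - 1)
          have h5 := h3 (j + 1)
          -- The derivative of `E t exp (2Bt)` dominates `E + 2Bκ`, so this correction absorbs both
          -- the forcing and its own feedback.
          have h6 : E ≤ E * Real.exp (2 * B * x) :=
            le_mul_of_one_le_right hE (Real.one_le_exp (by have := hx.1; positivity))
          have h7 : dL x = dp j x - (E * Real.exp (2 * B * x) + 2 * B * κ) - 2 * B * h := by
            simp only [dL, κ, h]; ring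
          rw [h7]
          linarith
      linarith
  have hlim : Tendsto (fun m : ℕ => p 0 T - E * T * Real.exp (2 * B * T)
      - Y * ((2 * B * T) ^ m / m.factorial)) atTop
      (𝓝 (p 0 T - E * T * Real.exp (2 * B * T) - Y * 0)) :=
    ((FloorSemiring.tendsto_pow_div_factorial_atTop _).const_mul Y).const_sub _
  have := le_of_tendsto' hlim fun m => key m 0 T ⟨hT, le_rfl⟩
  simpa [p] using this

/-- `exp (c n^b)` eventually dominates `A n^r exp (τ n^a)` when `a < b`. -/
lemma exists_nat_mul_rpow_mul_exp_lt {a b c A r τ : ℝ} (ha : a < b) (hb : 0 < b) (hc : 0 < c)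
    (hA : 0 < A) (hr : 0 < r) :
    ∃ n : ℕ, 1 ≤ n ∧ A * ((n : ℝ) ^ r * Real.exp (τ * (n : ℝ) ^ a)) < Real.exp (c * (n : ℝ) ^ b) := by
  -- After taking logarithms, each of the three terms on the left gets a quarter of the budget `c
  -- x^b`.
  have h1 : ∀ᶠ x : ℝ in atTop, ‖Real.log x‖ ≤ c / (4 * r) * ‖x ^ b‖ :=
    (isLittleO_log_rpow_atTop hb).bound (by positivity)
  have h2 : ∀ᶠ x : ℝ in atTop, 4 * |τ| / c ≤ x ^ (b - a) :=
    (tendsto_rpow_atTop (sub_pos.mpr ha)).eventually_ge_atTop _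
  have h3 : ∀ᶠ x : ℝ in atTop, 4 * |Real.log A| / c ≤ x ^ b :=
    (tendsto_rpow_atTop hb).eventually_ge_atTop _
  have h4 := tendsto_natCast_atTop_atTop (R := ℝ) |>.eventually
    (h1.and (h2.and (h3.and (eventually_ge_atTop 1))))
  obtain ⟨n, h1, h2, h3, h4⟩ := h4.exists
  refine ⟨n, by exact_mod_cast h4, ?_⟩
  set x : ℝ := (n : ℝ)
  have hx : 0 < x := by linarith
  have hxb : 0 < x ^ b := Real.rpow_pos_of_pos hx b
  have hxa : 0 < x ^ a := Real.rpow_pos_of_pos hx a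
  rw [← Real.exp_log hA, Real.rpow_def_of_pos hx r, ← Real.exp_add, ← Real.exp_add, Real.exp_lt_exp]
  have e1 : Real.log x * r ≤ c / 4 * x ^ b := by
    have := (le_abs_self _).trans h1
    rw [Real.norm_of_nonneg hxb.le] at this
    calc Real.log x * r ≤ (c / (4 * r) * x ^ b) * r := by gcongr
      _ = c / 4 * x ^ b := by field_simp
  have e2 : τ * x ^ a ≤ c / 4 * x ^ b := by
    have hsplit : x ^ b = x ^ (b - a) * x ^ a := by rw [← Real.rpow_add hx]; congr 1; ring
    rw [div_le_iff₀ hc] at h2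
    rw [hsplit]
    have := le_abs_self τ
    nlinarith
  have e3 : Real.log A ≤ c / 4 * x ^ b := by
    rw [div_le_iff₀ hc] at h3
    have := le_abs_self (Real.log A)
    linarith
  have : 0 < c * x ^ b := by positivity
  linarith

/-- A higher power of `x ≥ 1` dominates a lower one with an arbitrarily small constant. -/
lemma exists_rpow_le_mul_rpow_add {a b δ : ℝ} (ha : 0 ≤ a) (hab : a < b) (hδ : 0 < δ) :
    ∃ C : ℝ, 0 ≤ C ∧ ∀ x : ℝ, 1 ≤ x → x ^ a ≤ δ * x ^ b + C := by
  obtain ⟨X, hX⟩ := eventually_atTop.mp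
    ((tendsto_rpow_atTop (sub_pos.mpr hab)).eventually_ge_atTop (1 / δ))
  -- Beyond `X` the `δ` term suffices; below it `x ^ a` is bounded by the constant.
  refine ⟨|X| ^ a, by positivity, fun x hx => ?_⟩
  have hx0 : 0 < x := by linarith
  have h1 : 0 ≤ |X| ^ a := by positivity
  rcases le_total X x with h | h
  · have := hX x h
    have hsplit : x ^ b = x ^ (b - a) * x ^ a := by rw [← Real.rpow_add hx0]; congr 1; ring
    have hxa : 0 < x ^ a := Real.rpow_pos_of_pos hx0 a
    rw [div_le_iff₀ hδ] at this
    rw [hsplit]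
    nlinarith
  · have : x ^ a ≤ |X| ^ a := Real.rpow_le_rpow hx0.le (h.trans (le_abs_self X)) ha
    have : 0 ≤ δ * x ^ b := by positivity
    linarith

end

section

open MeasureTheory Set Filter Topology

/-! ### Sobolev bounds and Fourier multipliers -/

lemma freqNorm_nonneg (k : Fin 2 → ℤ) : 0 ≤ freqNorm k := Real.sqrt_nonneg _

lemma sq_freqNorm (k : Fin 2 → ℤ) : freqNorm k ^ 2 = (k 0 : ℝ) ^ 2 + (k 1 : ℝ) ^ 2 :=
  Real.sq_sqrt (by positivity)

/-- A bound on the Sobolev norm, in terms of partial sums. -/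
def SobolevBound (q : ℝ) (f : L2) (M : ℝ) : Prop :=
  ∀ s : Finset (Fin 2 → ℤ), ∑ k ∈ s, (1 + freqNorm k ^ 2) ^ q * ‖coeff f k‖ ^ 2 ≤ M ^ 2

lemma sobolevBound_of_sobolevNorm_le {q M : ℝ} {f : L2} (hM : 0 ≤ M)
    (h : sobolevNorm q f ≤ ENNReal.ofReal M) : SobolevBound q f M := by
  intro s
  have hnn : ∀ k, 0 ≤ (1 + freqNorm k ^ 2) ^ q * ‖coeff f k‖ ^ 2 := fun k => by positivity
  have h1 : (∑' k : Fin 2 → ℤ, ENNReal.ofReal ((1 + freqNorm k ^ 2) ^ q * ‖coeff f k‖ ^ 2))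
      ≤ ENNReal.ofReal (M ^ 2) := by
    have := ENNReal.rpow_le_rpow h (by norm_num : (0 : ℝ) ≤ 2)
    rw [sobolevNorm, ← ENNReal.rpow_mul] at this
    norm_num at this
    rwa [ENNReal.ofReal_pow hM]
  have h2 := (ENNReal.sum_le_tsum s).trans h1
  rw [← ENNReal.ofReal_sum_of_nonneg fun k _ => hnn k] at h2
  exact (ENNReal.ofReal_le_ofReal_iff (by positivity)).mp h2

lemma SobolevBound.sub {q M : ℝ} {f g : L2} (hf : SobolevBound q f M) (hg : SobolevBound q g M) :
    SobolevBound q (f - g) (2 * M) := by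
  intro s
  calc ∑ k ∈ s, (1 + freqNorm k ^ 2) ^ q * ‖coeff (f - g) k‖ ^ 2
      ≤ ∑ k ∈ s, (2 * ((1 + freqNorm k ^ 2) ^ q * ‖coeff f k‖ ^ 2)
          + 2 * ((1 + freqNorm k ^ 2) ^ q * ‖coeff g k‖ ^ 2)) := by
        refine Finset.sum_le_sum fun k _ => ?_
        have h1 : ‖coeff (f - g) k‖ ^ 2 ≤ 2 * ‖coeff f k‖ ^ 2 + 2 * ‖coeff g k‖ ^ 2 := by
          rw [coeff_sub]
          have h2 := norm_sub_le (coeff f k) (coeff g k)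
          nlinarith [norm_nonneg (coeff f k - coeff g k), sq_nonneg (‖coeff f k‖ - ‖coeff g k‖)]
        have h3 : 0 ≤ (1 + freqNorm k ^ 2) ^ q := by positivity
        nlinarith
    _ ≤ (2 * M) ^ 2 := by
        rw [Finset.sum_add_distrib, ← Finset.mul_sum, ← Finset.mul_sum]
        have := hf s
        have := hg s
        nlinarith

lemma SobolevBound.norm_coeff_le {q M : ℝ} {f : L2} (hf : SobolevBound q f M) (hM : 0 ≤ M)
    (hq : 0 ≤ q) (k : Fin 2 → ℤ) : ‖coeff f k‖ ≤ M := by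
  have h := hf {k}
  rw [Finset.sum_singleton] at h
  have h1 : 1 ≤ (1 + freqNorm k ^ 2) ^ q :=
    Real.one_le_rpow (by have := sq_nonneg (freqNorm k); linarith) hq
  refine abs_le_of_sq_le_sq' ?_ hM |>.2
  nlinarith [sq_nonneg ‖coeff f k‖]

/-- `L²` bound for the image of a function under a Fourier multiplier. -/
lemma SobolevBound.norm_sq_le {q M δ C : ℝ} {f g : L2} {m : (Fin 2 → ℤ) → ℂ}
    (hf : SobolevBound q f M) (hg : IsMultiplierImage m f g) (hδ : 0 ≤ δ)
    (hm : ∀ k, ‖m k‖ ^ 2 ≤ δ * (1 + freqNorm k ^ 2) ^ q + C) :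
    ‖g‖ ^ 2 ≤ δ * ((2 * Real.pi) ^ 2 * M ^ 2) + C * ‖f‖ ^ 2 := by
  have hs : Summable fun k => (1 + freqNorm k ^ 2) ^ q * ‖coeff f k‖ ^ 2 :=
    summable_of_sum_le (fun k => by positivity) hf
  have hS := hs.tsum_le_of_sum_le hf
  have h := hasSum_le (fun k => ?_) (hasSum_sq_coeff g)
    ((hs.hasSum.mul_left δ).add ((hasSum_sq_coeff f).mul_left C))
  · have h2 := mul_le_mul_of_nonneg_left h (by positivity : 0 ≤ (2 * Real.pi) ^ 2)
    have hc : (2 * Real.pi) ^ 2 * (2 * Real.pi)⁻¹ ^ 2 = 1 := by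
      rw [← mul_pow, mul_inv_cancel₀ Real.two_pi_pos.ne', one_pow]
    have h3 := mul_le_mul_of_nonneg_left hS (by positivity : 0 ≤ (2 * Real.pi) ^ 2 * δ)
    calc ‖g‖ ^ 2 = (2 * Real.pi) ^ 2 * ((2 * Real.pi)⁻¹ ^ 2 * ‖g‖ ^ 2) := by
          rw [← mul_assoc, hc, one_mul]
      _ ≤ _ := h2
      _ = (2 * Real.pi) ^ 2 * δ * (∑' k, (1 + freqNorm k ^ 2) ^ q * ‖coeff f k‖ ^ 2)
            + C * (((2 * Real.pi) ^ 2 * (2 * Real.pi)⁻¹ ^ 2) * ‖f‖ ^ 2) := by ring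
      _ ≤ _ := by rw [hc, one_mul]; linarith
  · rw [hg k, norm_mul, mul_pow]
    have := mul_le_mul_of_nonneg_right (hm k) (sq_nonneg ‖coeff f k‖)
    linarith

lemma IsMultiplierImage.sub {f g f' g' : L2} {m : (Fin 2 → ℤ) → ℂ}
    (h : IsMultiplierImage m f g) (h' : IsMultiplierImage m f' g') :
    IsMultiplierImage m (f - f') (g - g') := fun k => by
  rw [coeff_sub, coeff_sub, h k, h' k, mul_sub]

/-- A Fourier multiplier of order less than `q` maps an `L²`-continuous curve which is bounded in
`H^q` to an `L²`-continuous curve. -/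
lemma continuousOn_of_isMultiplierImage {q M : ℝ} {S : Set ℝ} {f g : ℝ → L2}
    {m : (Fin 2 → ℤ) → ℂ} (hf : ∀ t ∈ S, SobolevBound q (f t) M) (hc : ContinuousOn f S)
    (hg : ∀ t ∈ S, IsMultiplierImage m (f t) (g t))
    (hm : ∀ δ > 0, ∃ C, 0 ≤ C ∧ ∀ k, ‖m k‖ ^ 2 ≤ δ * (1 + freqNorm k ^ 2) ^ q + C) :
    ContinuousOn g S := by
  rw [Metric.continuousOn_iff] at hc ⊢
  intro t ht η hη
  set A := (2 * Real.pi) ^ 2 * (2 * M) ^ 2 with hA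
  have hA0 : 0 ≤ A := by positivity
  -- With this `δ`, the part controlled by the `H^q` bound costs at most `η² / 2`; the rest is
  -- controlled by continuity in `L²`.
  obtain ⟨C, hC, hmC⟩ := hm (η ^ 2 / (2 * (A + 1))) (by positivity)
  obtain ⟨d, hd, h⟩ := hc t ht (η / (2 * (C + 1))) (by positivity)
  refine ⟨d, hd, fun a ha had => ?_⟩
  have h1 := h a ha had
  rw [dist_eq_norm] at h1 ⊢
  have h2 := ((hf a ha).sub (hf t ht)).norm_sq_le ((hg a ha).sub (hg t ht)) (by positivity) hmC
  rw [← hA] at h2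
  have h3 : η ^ 2 / (2 * (A + 1)) * A ≤ η ^ 2 / 2 := by
    rw [div_mul_eq_mul_div, div_le_div_iff₀ (by positivity) (by positivity)]
    nlinarith [sq_nonneg η]
  have h4 : C * ‖f a - f t‖ ^ 2 < η ^ 2 / 2 := by
    have h5 : ‖f a - f t‖ ^ 2 ≤ (η / (2 * (C + 1))) ^ 2 := by
      gcongr
    have h6 : C * (η / (2 * (C + 1))) ^ 2 < η ^ 2 / 2 := by
      rw [div_pow, mul_div_assoc', div_lt_div_iff₀ (by positivity) (by positivity)]
      have : 0 < η ^ 2 := by positivity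
      nlinarith [mul_nonneg hC hC, mul_nonneg (mul_nonneg hC hC) this.le, mul_nonneg hC this.le]
    nlinarith
  exact abs_lt_of_sq_lt_sq' (by linarith) hη.le |>.2

lemma norm_coeff_le_norm (f : L2) (k : Fin 2 → ℤ) : ‖coeff f k‖ ≤ ‖f‖ := by
  have h := le_hasSum (hasSum_sq_coeff f) k fun _ _ => by positivity
  have h1 : (2 * Real.pi)⁻¹ ^ 2 ≤ 1 := by
    have : (2 * Real.pi)⁻¹ ≤ 1 := inv_le_one_of_one_le₀ (by linarith [Real.pi_gt_three])
    have : 0 ≤ (2 * Real.pi)⁻¹ := by have := Real.two_pi_pos; positivity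
    exact pow_le_one₀ this (by assumption)
  refine abs_le_of_sq_le_sq' ?_ (norm_nonneg f) |>.2
  nlinarith [sq_nonneg ‖f‖]

lemma continuous_coeff (k : Fin 2 → ℤ) : Continuous fun f => coeff f k := by
  refine LipschitzWith.continuous (K := 1) (LipschitzWith.of_dist_le_mul fun f g => ?_)
  rw [NNReal.coe_one, one_mul, dist_eq_norm, dist_eq_norm, ← coeff_sub]
  exact norm_coeff_le_norm _ _

/-! ### Multiplication by a cosine -/

lemma norm_mul_cosine_le (f : L2) (k : Fin 2 → ℤ) (x : Torus) :
    ‖f x * cosine k x‖ ≤ ‖f x‖ := by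
  rw [norm_mul]
  exact mul_le_of_le_one_right (norm_nonneg _) (abs_cosine_le k x)

lemma memLp_mul_cosine (f : L2) (k : Fin 2 → ℤ) :
    MemLp (fun x => f x * cosine k x) 2 (volume : Measure Torus) :=
  (Lp.memLp f).mono ((Lp.aestronglyMeasurable f).mul (continuous_cosine k).aestronglyMeasurable)
    (ae_of_all _ (norm_mul_cosine_le f k))

/-- Multiplication by `cos (k · x)` on `L²`. -/
def mulCosine (k : Fin 2 → ℤ) (f : L2) : L2 := (memLp_mul_cosine f k).toLp _

lemma coeFn_mulCosine (k : Fin 2 → ℤ) (f : L2) :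
    mulCosine k f =ᵐ[volume] fun x => f x * cosine k x := MemLp.coeFn_toLp _

lemma norm_mulCosine_le (k : Fin 2 → ℤ) (f : L2) : ‖mulCosine k f‖ ≤ ‖f‖ := by
  refine Lp.norm_le_norm_of_ae_le ?_
  filter_upwards [coeFn_mulCosine k f] with x h
  rw [h]
  exact norm_mul_cosine_le f k x

lemma mulCosine_sub (k : Fin 2 → ℤ) (f g : L2) :
    mulCosine k (f - g) = mulCosine k f - mulCosine k g := by
  apply Lp.ext
  filter_upwards [coeFn_mulCosine k f, coeFn_mulCosine k g, coeFn_mulCosine k (f - g),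
    Lp.coeFn_sub f g, Lp.coeFn_sub (mulCosine k f) (mulCosine k g)] with x h1 h2 h3 h4 h5
  rw [h3, h5, h4, Pi.sub_apply, Pi.sub_apply, h1, h2, sub_mul]

lemma continuous_mulCosine (k : Fin 2 → ℤ) : Continuous (mulCosine k) := by
  refine LipschitzWith.continuous (K := 1) (LipschitzWith.of_dist_le_mul fun f g => ?_)
  rw [NNReal.coe_one, one_mul, dist_eq_norm, dist_eq_norm, ← mulCosine_sub]
  exact norm_mulCosine_le _ _

/-- A product of two `L²` functions is only integrable; tested against a cosine it becomes an inner
product, so bounds and time continuity come from `L²` alone. -/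
lemma inner_mulCosine (k : Fin 2 → ℤ) (f g : L2) :
    inner ℝ f (mulCosine k g) = ∫ x : Torus, f x * g x * cosine k x := by
  rw [MeasureTheory.L2.inner_def]
  apply integral_congr_ae
  filter_upwards [coeFn_mulCosine k g] with x h
  rw [h, RCLike.inner_apply]
  simp only [conj_trivial]
  ring

lemma abs_inner_mulCosine_le (k : Fin 2 → ℤ) (f g : L2) :
    |inner ℝ f (mulCosine k g)| ≤ ‖f‖ * ‖g‖ :=
  (abs_real_inner_le_norm _ _).trans
    (mul_le_mul_of_nonneg_left (norm_mulCosine_le k g) (norm_nonneg f))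

lemma integrable_mul_mul_cosine (k : Fin 2 → ℤ) (f g : L2) :
    Integrable fun x : Torus => f x * g x * cosine k x := by
  have := MeasureTheory.L2.integrable_inner (𝕜 := ℝ) f (mulCosine k g)
  refine this.congr ?_
  filter_upwards [coeFn_mulCosine k g] with x h
  rw [h, RCLike.inner_apply]
  simp only [conj_trivial]
  ring

/-! ### The symbols of the equation -/

/-- The symbol of the velocity `(-Δ)^{α/2} I`. -/
def velocitySymbol (α : ℝ) (i : Fin 2) (k : Fin 2 → ℤ) : ℂ :=
  ((freqNorm k ^ α * symbolI k i : ℝ) : ℂ)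

lemma abs_symbolI_le (k : Fin 2 → ℤ) (i : Fin 2) : |symbolI k i| ≤ 1 := by
  have h : 0 ≤ (k 0 : ℝ) ^ 2 + (k 1 : ℝ) ^ 2 := by positivity
  fin_cases i
  · simp only [symbolI, Fin.zero_eta, Matrix.cons_val_zero, abs_div, abs_of_nonneg h]
    refine div_le_one_of_le₀ ?_ h
    rw [abs_neg, abs_mul, ← sq_abs (k 0 : ℝ), ← sq_abs (k 1 : ℝ)]
    nlinarith [sq_nonneg (|(k 0 : ℝ)| - |(k 1 : ℝ)|), sq_nonneg |(k 0 : ℝ)|, sq_nonneg |(k 1 : ℝ)|]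
  · simp only [symbolI, Fin.mk_one, Matrix.cons_val_one, Matrix.cons_val_fin_one, abs_div,
      abs_of_nonneg h]
    refine div_le_one_of_le₀ ?_ h
    rw [abs_of_nonneg (sq_nonneg _)]
    nlinarith [sq_nonneg (k 1 : ℝ)]

lemma norm_velocitySymbol_sq_le {α : ℝ} (hα : 0 ≤ α) (i : Fin 2) (k : Fin 2 → ℤ) :
    ‖velocitySymbol α i k‖ ^ 2 ≤ (1 + freqNorm k ^ 2) ^ α := by
  have h0 := freqNorm_nonneg k
  rw [velocitySymbol, Complex.norm_real, norm_mul, mul_pow, Real.norm_of_nonneg (by positivity),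
    Real.norm_eq_abs]
  have h1 : (freqNorm k ^ α) ^ 2 = (freqNorm k ^ 2) ^ α := by
    rw [← Real.rpow_natCast, ← Real.rpow_natCast, ← Real.rpow_mul h0, ← Real.rpow_mul h0, mul_comm]
  calc (freqNorm k ^ α) ^ 2 * |symbolI k i| ^ 2 ≤ (freqNorm k ^ α) ^ 2 * 1 := by
        gcongr
        exact pow_le_one₀ (abs_nonneg _) (abs_symbolI_le k i)
    _ ≤ _ := by
        rw [mul_one, h1]
        exact Real.rpow_le_rpow (by positivity) (by linarith) hα

lemma norm_gradientSymbol_sq_le {α : ℝ} (hα : 1 ≤ α) (i : Fin 2) (k : Fin 2 → ℤ) :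
    ‖Complex.I * (k i : ℂ)‖ ^ 2 ≤ (1 + freqNorm k ^ 2) ^ α := by
  have h : ‖Complex.I * (k i : ℂ)‖ ^ 2 = (k i : ℝ) ^ 2 := by
    rw [norm_mul, Complex.norm_I, one_mul, Complex.norm_intCast, sq_abs]
  have h1 : 1 ≤ 1 + freqNorm k ^ 2 := by have := sq_nonneg (freqNorm k); linarith
  rw [h]
  calc (k i : ℝ) ^ 2 ≤ 1 + freqNorm k ^ 2 := by
        rw [sq_freqNorm]
        have := sq_nonneg (k 0 : ℝ)
        have := sq_nonneg (k 1 : ℝ)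
        fin_cases i <;> simp <;> linarith
    _ = (1 + freqNorm k ^ 2) ^ (1 : ℝ) := (Real.rpow_one _).symm
    _ ≤ _ := Real.rpow_le_rpow_of_exponent_le h1 hα

/-- The strict gap `α < q` buys the small constant `δ`, hence time continuity of velocity and
gradient. -/
lemma exists_symbol_bound {α q : ℝ} (hα : 0 ≤ α) (hq : α < q) {m : (Fin 2 → ℤ) → ℂ}
    (hm : ∀ k, ‖m k‖ ^ 2 ≤ (1 + freqNorm k ^ 2) ^ α) :
    ∀ δ > 0, ∃ C, 0 ≤ C ∧ ∀ k, ‖m k‖ ^ 2 ≤ δ * (1 + freqNorm k ^ 2) ^ q + C := by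
  intro δ hδ
  obtain ⟨C, hC, h⟩ := exists_rpow_le_mul_rpow_add hα hq hδ
  exact ⟨C, hC, fun k => (hm k).trans (h _ (by have := sq_nonneg (freqNorm k); linarith))⟩

lemma SobolevBound.norm_le {α q M : ℝ} {f g : L2} {m : (Fin 2 → ℤ) → ℂ}
    (hf : SobolevBound q f M) (hM : 0 ≤ M) (hq : α ≤ q) (hg : IsMultiplierImage m f g)
    (hm : ∀ k, ‖m k‖ ^ 2 ≤ (1 + freqNorm k ^ 2) ^ α) : ‖g‖ ≤ 2 * Real.pi * M := by
  have h := hf.norm_sq_le (δ := 1) (C := 0) hg zero_le_one fun k => by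
    rw [one_mul, add_zero]
    exact (hm k).trans (Real.rpow_le_rpow_of_exponent_le
      (by have := sq_nonneg (freqNorm k); linarith) hq)
  rw [one_mul, zero_mul, add_zero, ← mul_pow] at h
  exact abs_le_of_sq_le_sq' h (by have := Real.two_pi_pos; positivity) |>.2

end

section

open MeasureTheory Set Filter Topology

/-! ### Norms of trigonometric monomials -/

lemma norm_coeff_mode_le (z : ℂ) (k l : Fin 2 → ℤ) : ‖coeff (mode z k) l‖ ≤ ‖z‖ := by
  rw [coeff_mode, norm_div, Complex.norm_two, div_le_iff₀ two_pos]
  refine (norm_add_le _ _).trans ?_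
  have h := norm_nonneg z
  split_ifs <;> simp <;> linarith

lemma coeff_mode_of_ne {z : ℂ} {k l : Fin 2 → ℤ} (h1 : l ≠ k) (h2 : l ≠ -k) :
    coeff (mode z k) l = 0 := by
  simp [coeff_mode, h1, h2]

lemma freqNorm_neg (k : Fin 2 → ℤ) : freqNorm (-k) = freqNorm k := by
  simp [freqNorm]

/-- Only `±k` contribute. They coincide when `k = 0`, so their number is merely bounded by two. -/
lemma tsum_weight_mode_le {w : (Fin 2 → ℤ) → ℝ} (hw : ∀ k, 0 ≤ w k) (hneg : ∀ k, w (-k) = w k)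
    (z : ℂ) (k : Fin 2 → ℤ) :
    ∑' l, ENNReal.ofReal (w l * ‖coeff (mode z k) l‖ ^ 2)
      ≤ ENNReal.ofReal (2 * (w k * ‖z‖ ^ 2)) := by
  classical
  rw [tsum_eq_sum (s := {k, -k})]
  · rw [← ENNReal.ofReal_sum_of_nonneg fun l _ => mul_nonneg (hw l) (sq_nonneg _)]
    refine ENNReal.ofReal_le_ofReal ?_
    have hle : ∀ l ∈ ({k, -k} : Finset (Fin 2 → ℤ)),
        w l * ‖coeff (mode z k) l‖ ^ 2 ≤ w k * ‖z‖ ^ 2 := by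
      intro l hl
      have hwl : w l = w k := by
        rcases Finset.mem_insert.mp hl with h | h
        · rw [h]
        · rw [Finset.mem_singleton.mp h, hneg]
      rw [hwl]
      have := norm_coeff_mode_le z k l
      have := hw k
      gcongr
    refine (Finset.sum_le_card_nsmul _ _ _ hle).trans ?_
    rw [nsmul_eq_mul]
    have hcard : ((({k, -k} : Finset (Fin 2 → ℤ)).card : ℕ) : ℝ) ≤ 2 := by
      exact_mod_cast Finset.card_le_two
    exact mul_le_mul_of_nonneg_right hcard (mul_nonneg (hw k) (sq_nonneg _))
  · intro l hl
    simp only [Finset.mem_insert, Finset.mem_singleton, not_or] at hl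
    simp [coeff_mode_of_ne hl.1 hl.2]

lemma sobolevNorm_mode_lt_top (q : ℝ) (z : ℂ) (k : Fin 2 → ℤ) : sobolevNorm q (mode z k) < ⊤ := by
  refine ENNReal.rpow_lt_top_of_nonneg (by norm_num) ?_
  refine ne_top_of_le_ne_top ENNReal.ofReal_ne_top
    (tsum_weight_mode_le (fun k => by positivity) (fun k => by rw [freqNorm_neg]) z k)

lemma gevreyNorm_mode_le (r s τ : ℝ) (z : ℂ) (k : Fin 2 → ℤ) :
    gevreyNorm r s τ (mode z k)
      ≤ ENNReal.ofReal (2 * (freqNorm k ^ r * Real.exp (τ * freqNorm k ^ (1 / s))) * ‖z‖) := by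
  have hk := freqNorm_nonneg k
  set G := freqNorm k ^ r * Real.exp (τ * freqNorm k ^ (1 / s)) with hG
  have hG0 : 0 ≤ G := by positivity
  have h1 : (∑' k' : {k' : Fin 2 → ℤ // k' ≠ 0},
      ENNReal.ofReal (freqNorm k' ^ (2 * r) * Real.exp (2 * τ * freqNorm k' ^ (1 / s))
        * ‖coeff (mode z k) k'‖ ^ 2)) ≤ ENNReal.ofReal ((2 * G * ‖z‖) ^ 2) := by
    refine (ENNReal.tsum_comp_le_tsum_of_injective Subtype.val_injective
      (fun l => ENNReal.ofReal (freqNorm l ^ (2 * r) * Real.exp (2 * τ * freqNorm l ^ (1 / s))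
        * ‖coeff (mode z k) l‖ ^ 2))).trans ?_
    refine (tsum_weight_mode_le
      (w := fun l => freqNorm l ^ (2 * r) * Real.exp (2 * τ * freqNorm l ^ (1 / s)))
      (fun l => by have := freqNorm_nonneg l; positivity)
      (fun l => by rw [freqNorm_neg]) z k).trans (ENNReal.ofReal_le_ofReal ?_)
    have h2 : freqNorm k ^ (2 * r) * Real.exp (2 * τ * freqNorm k ^ (1 / s)) = G ^ 2 := by
      rw [hG, mul_pow, ← Real.exp_nat_mul, ← Real.rpow_natCast (freqNorm k ^ r),
        ← Real.rpow_mul hk]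
      congr 2
      · push_cast; ring
      · push_cast; ring
    rw [h2]
    nlinarith [mul_nonneg (sq_nonneg G) (sq_nonneg ‖z‖)]
  have h3 := ENNReal.rpow_le_rpow h1 (by norm_num : (0 : ℝ) ≤ 1 / 2)
  refine h3.trans (le_of_eq ?_)
  rw [ENNReal.ofReal_rpow_of_nonneg (by positivity) (by norm_num), ← Real.sqrt_eq_rpow,
    Real.sqrt_sq (by positivity)]

/-- The crude factor `2` comes from `(a + b)² ≤ 2a² + 2b²`; a bound independent of the perturbation
is all that is required. -/
lemma gevreyNorm_add_le (r s τ : ℝ) (f g : L2) :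
    gevreyNorm r s τ (f + g) ≤ 2 * gevreyNorm r s τ f + 2 * gevreyNorm r s τ g := by
  unfold gevreyNorm
  set w : {k : Fin 2 → ℤ // k ≠ 0} → ℝ := fun k =>
    freqNorm k ^ (2 * r) * Real.exp (2 * τ * freqNorm k ^ (1 / s)) with hw
  have hw0 : ∀ k, 0 ≤ w k := fun k => by have := freqNorm_nonneg (k : Fin 2 → ℤ); positivity
  set X := ∑' k : {k : Fin 2 → ℤ // k ≠ 0}, ENNReal.ofReal (w k * ‖coeff f k‖ ^ 2)
  set Y := ∑' k : {k : Fin 2 → ℤ // k ≠ 0}, ENNReal.ofReal (w k * ‖coeff g k‖ ^ 2)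
  have h1 : ∑' k : {k : Fin 2 → ℤ // k ≠ 0}, ENNReal.ofReal (w k * ‖coeff (f + g) k‖ ^ 2)
      ≤ 2 * X + 2 * Y := by
    rw [← ENNReal.tsum_mul_left, ← ENNReal.tsum_mul_left, ← ENNReal.tsum_add]
    refine ENNReal.tsum_le_tsum fun k => ?_
    have h2 : ‖coeff (f + g) k‖ ^ 2 ≤ 2 * ‖coeff f k‖ ^ 2 + 2 * ‖coeff g k‖ ^ 2 := by
      rw [coeff_add]
      have := norm_add_le (coeff f k) (coeff g k)
      nlinarith [norm_nonneg (coeff f k + coeff g k),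
        sq_nonneg (‖coeff f (k : Fin 2 → ℤ)‖ - ‖coeff g k‖)]
    have hf : 0 ≤ w k * ‖coeff f k‖ ^ 2 := mul_nonneg (hw0 k) (sq_nonneg _)
    have hg : 0 ≤ w k * ‖coeff g k‖ ^ 2 := mul_nonneg (hw0 k) (sq_nonneg _)
    rw [two_mul (ENNReal.ofReal _), two_mul (ENNReal.ofReal _), ← ENNReal.ofReal_add hf hf, ← ENNReal.ofReal_add hg hg,
      ← ENNReal.ofReal_add (add_nonneg hf hf) (add_nonneg hg hg)]
    refine ENNReal.ofReal_le_ofReal ?_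
    have := mul_le_mul_of_nonneg_left h2 (hw0 k)
    linarith
  have h3 : ∀ W : ℝ≥0∞, (2 * W) ^ (1 / 2 : ℝ) ≤ 2 * W ^ (1 / 2 : ℝ) := by
    intro W
    rw [ENNReal.mul_rpow_of_nonneg _ _ (by norm_num)]
    gcongr
    exact (ENNReal.rpow_le_rpow_of_exponent_le (by norm_num) (by norm_num)).trans
      (ENNReal.rpow_one 2).le
  calc _ ≤ (2 * X + 2 * Y) ^ (1 / 2 : ℝ) := ENNReal.rpow_le_rpow h1 (by norm_num)
    _ ≤ (2 * X) ^ (1 / 2 : ℝ) + (2 * Y) ^ (1 / 2 : ℝ) :=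
        ENNReal.rpow_add_le_add_rpow _ _ (by norm_num) (by norm_num)
    _ ≤ _ := add_le_add (h3 X) (h3 Y)

lemma meanFree_of_coeff_zero {f : L2} (h : coeff f 0 = 0) : MeanFree f := by
  have := integral_mul_cosine f 0
  simpa [cosine, character_zero, h, MeanFree] using this

/-! ### The stationary shear flow -/

/-- The stationary solution `-2 sin x₂`. -/
def shear : L2 := mode (2 * Complex.I) ![0, 1]

lemma coeff_shear_of_ne {k : Fin 2 → ℤ} (hk : k 0 ≠ 0) : coeff shear k = 0 :=
  coeff_mode_of_ne (fun h => hk (by simp [h])) (fun h => hk (by simp [h]))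

/-- Both components of `symbolI` contain the factor `k 0`, so functions of `x₂` alone induce no
velocity. -/
lemma velocitySymbol_eq_zero (α : ℝ) (i : Fin 2) {k : Fin 2 → ℤ} (hk : k 0 = 0) :
    velocitySymbol α i k = 0 := by
  fin_cases i <;> simp [velocitySymbol, symbolI, hk]

lemma velocitySymbol_mul_coeff_shear (α : ℝ) (i : Fin 2) (k : Fin 2 → ℤ) :
    velocitySymbol α i k * coeff shear k = 0 := by
  by_cases hk : k 0 = 0
  · rw [velocitySymbol_eq_zero α i hk, zero_mul]
  · rw [coeff_shear_of_ne hk, mul_zero]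

/-- The gradient `(0, -2 cos x₂)` of the shear flow. -/
def shearGradient : Fin 2 → L2 := ![0, mode (-2) ![0, 1]]

lemma isGradient_shear : IsGradient shear shearGradient := by
  intro i k
  have hne : (![0, 1] : Fin 2 → ℤ) ≠ -![0, 1] := fun h => by simpa using congrFun h 1
  have c1 : ∀ z, coeff (mode z ![0, 1]) ![0, 1] = z / 2 := fun z => by simp [coeff_mode]
  have c2 : ∀ z, coeff (mode z ![0, 1]) (-![0, 1]) = starRingEnd ℂ z / 2 := fun z => by
    rw [coeff_mode, if_neg hne.symm, if_pos rfl, zero_add]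
  by_cases h1 : k = ![0, 1]
  · subst h1
    fin_cases i
    · simp [shearGradient, coeff_zero]
    · change coeff (mode (-2) ![0, 1]) ![0, 1] = _
      rw [shear, c1, c1]
      simp
  · by_cases h2 : k = -![0, 1]
    · subst h2
      fin_cases i
      · simp [shearGradient, coeff_zero]
      · change coeff (mode (-2) ![0, 1]) (-![0, 1]) = _
        rw [shear, c2, c2]
        have : starRingEnd ℂ 2 = 2 := Complex.conj_ofNat 2
        simp only [map_mul, this, Complex.conj_I, map_neg]
        simp only [Pi.neg_apply]
        push_cast
        linear_combination -Complex.I_sq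
    · fin_cases i
      · simp [shearGradient, coeff_zero, shear, coeff_mode_of_ne h1 h2]
      · simp [shearGradient, shear, coeff_mode_of_ne h1 h2]

lemma meanFree_mode (z : ℂ) {k : Fin 2 → ℤ} (hk : k ≠ 0) : MeanFree (mode z k) :=
  meanFree_of_coeff_zero (coeff_mode_of_ne hk.symm (neg_ne_zero.mpr hk).symm)

lemma freq_ne_zero : (![0, 1] : Fin 2 → ℤ) ≠ 0 := fun h => by simpa using congrFun h 1

lemma isSolution_shear (α q T : ℝ) : IsSolution α q T shear fun _ => shear where
  continuousOn := continuousOn_const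
  bounded := ⟨(sobolevNorm q shear).toNNReal, fun t _ =>
    (ENNReal.coe_toNNReal (sobolevNorm_mode_lt_top q _ _).ne).ge⟩
  meanFree _ _ := meanFree_mode _ freq_ne_zero
  initial := rfl
  equation := by
    refine ⟨fun _ _ => 0, fun _ => shearGradient, fun t _ => ⟨fun i k => ?_, isGradient_shear⟩, ?_⟩
    · rw [coeff_zero]
      exact (velocitySymbol_mul_coeff_shear α i k).symm
    · intro φ _ t _
      simp

lemma IsSolution.mono {α q T T' : ℝ} {θ₀ : L2} {θ : ℝ → L2} (h : IsSolution α q T' θ₀ θ)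
    (hT : T ≤ T') : IsSolution α q T θ₀ θ := by
  have hsub : Icc 0 T ⊆ Icc 0 T' := Icc_subset_Icc_right hT
  obtain ⟨M, hM⟩ := h.bounded
  obtain ⟨u, g, h1, h2⟩ := h.equation
  exact ⟨h.continuousOn.mono hsub, ⟨M, fun t ht => hM t (hsub ht)⟩,
    fun t ht => h.meanFree t (hsub ht), h.initial,
    u, g, fun t ht => h1 t (hsub ht), fun φ hφ t ht => h2 φ hφ t (hsub ht)⟩

/-! ### Growth of perturbations of the shear flow -/

/-- The second component of the velocity symbol at the frequency `(n, j)`. -/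
def growthRate (α : ℝ) (n : ℕ) (j : ℤ) : ℝ :=
  freqNorm ![(n : ℤ), j] ^ α * ((n : ℝ) ^ 2 / ((n : ℝ) ^ 2 + (j : ℝ) ^ 2))

lemma velocitySymbol_one (α : ℝ) (n : ℕ) (j : ℤ) :
    velocitySymbol α 1 ![(n : ℤ), j] = (growthRate α n j : ℂ) := by
  simp [velocitySymbol, symbolI, growthRate]

lemma growthRate_nonneg (α : ℝ) (n : ℕ) (j : ℤ) : 0 ≤ growthRate α n j :=
  mul_nonneg (Real.rpow_nonneg (freqNorm_nonneg _) _) (by positivity)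

/-- Here `α ≤ 2` enters: `|k|^α / |k|² ≤ 1` for `|k| ≥ 1`. Uniformity in `j` is what the comparison
principle requires. -/
lemma growthRate_le {α : ℝ} (hα : α ≤ 2) {n : ℕ} (hn : 1 ≤ n) (j : ℤ) :
    growthRate α n j ≤ (n : ℝ) ^ 2 := by
  have hn1 : (1 : ℝ) ≤ n := by exact_mod_cast hn
  have hsq : freqNorm ![(n : ℤ), j] ^ 2 = (n : ℝ) ^ 2 + (j : ℝ) ^ 2 := by simp [sq_freqNorm]
  have h0 : 0 < (n : ℝ) ^ 2 + (j : ℝ) ^ 2 := by positivity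
  have h1 : 1 ≤ freqNorm ![(n : ℤ), j] := by
    refine abs_le_of_sq_le_sq' ?_ (freqNorm_nonneg _) |>.2
    rw [hsq]
    nlinarith [sq_nonneg (j : ℝ)]
  have h2 : freqNorm ![(n : ℤ), j] ^ α ≤ (n : ℝ) ^ 2 + (j : ℝ) ^ 2 := by
    rw [← hsq, ← Real.rpow_two]
    exact Real.rpow_le_rpow_of_exponent_le h1 hα
  calc growthRate α n j
      ≤ ((n : ℝ) ^ 2 + (j : ℝ) ^ 2) * ((n : ℝ) ^ 2 / ((n : ℝ) ^ 2 + (j : ℝ) ^ 2)) := by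
        unfold growthRate; gcongr
    _ = (n : ℝ) ^ 2 := by field_simp

lemma half_rpow_le_growthRate {α : ℝ} (hα : 0 ≤ α) {n : ℕ} (hn : 1 ≤ n) {j : ℤ}
    (hj : (j : ℝ) ^ 2 ≤ 1) : (n : ℝ) ^ α / 2 ≤ growthRate α n j := by
  have hn1 : (1 : ℝ) ≤ n := by exact_mod_cast hn
  have hsq : freqNorm ![(n : ℤ), j] ^ 2 = (n : ℝ) ^ 2 + (j : ℝ) ^ 2 := by simp [sq_freqNorm]
  have h1 : (n : ℝ) ≤ freqNorm ![(n : ℤ), j] := by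
    refine abs_le_of_sq_le_sq' ?_ (freqNorm_nonneg _) |>.2
    rw [hsq]
    nlinarith [sq_nonneg (j : ℝ)]
  have h2 : (n : ℝ) ^ α ≤ freqNorm ![(n : ℤ), j] ^ α := Real.rpow_le_rpow (by positivity) h1 hα
  have h3 : 1 / 2 ≤ (n : ℝ) ^ 2 / ((n : ℝ) ^ 2 + (j : ℝ) ^ 2) := by
    rw [div_le_div_iff₀ two_pos (by positivity)]
    nlinarith
  rw [div_eq_mul_one_div, growthRate]
  exact mul_le_mul h2 h3 (by norm_num) (Real.rpow_nonneg (freqNorm_nonneg _) _)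

lemma inner_mulCosine_shearGradient (u : L2) (n : ℕ) (j : ℤ) :
    inner ℝ u (mulCosine ![(n : ℤ), j] (shearGradient 1)) = -((2 * Real.pi) ^ 2 *
      ((coeff u ![(n : ℤ), j - 1]).re + (coeff u ![(n : ℤ), j + 1]).re)) := by
  have e1 : (![(n : ℤ), j] + ![0, 1] : Fin 2 → ℤ) = ![(n : ℤ), j + 1] := by simp
  have e2 : (![(n : ℤ), j] - ![0, 1] : Fin 2 → ℤ) = ![(n : ℤ), j - 1] := by simp
  rw [mul_add, ← integral_mul_cosine, ← integral_mul_cosine,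
    ← integral_add (integrable_mul_cosine _ _) (integrable_mul_cosine _ _), ← integral_neg,
    inner_mulCosine]
  apply integral_congr_ae
  filter_upwards [coeFn_mode (-2) ![0, 1]] with x hx
  have h := cosine_mul_cosine ![0, 1] ![(n : ℤ), j] x
  rw [e1, e2] at h
  have h2 : shearGradient 1 x = -2 * cosine ![0, 1] x := by
    change mode (-2) ![0, 1] x = _
    rw [hx, cosine]
    simp
  rw [h2]
  linear_combination (-(u x)) * h

/-- A perturbation of the shear flow by a multiple of `cos (n x₁)` grows like `exp (n^α t / 2)`, up
to a quadratic error. -/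
lemma IsSolution.growth {α q T M ε : ℝ} {n : ℕ} {θ : ℝ → L2} (hα : 1 ≤ α) (hα2 : α ≤ 2)
    (hq : α < q) (hT : 0 ≤ T) (hM : 0 ≤ M) (hε : 0 ≤ ε) (hn : 1 ≤ n)
    (h : IsSolution α q T (shear + mode (2 * ε : ℝ) ![(n : ℤ), 0]) θ)
    (hb : ∀ t ∈ Icc 0 T, SobolevBound q (θ t - shear) M) :
    ε * Real.cosh ((n : ℝ) ^ α / 2 * T) - 2 * M ^ 2 * T * Real.exp (2 * (n : ℝ) ^ 2 * T) ≤ M := by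
  have hα0 : 0 ≤ α := by linarith
  have hπ := Real.two_pi_pos
  obtain ⟨u, g, hug, hweak⟩ := h.equation
  have hρc : ContinuousOn (fun t => θ t - shear) (Icc 0 T) := h.continuousOn.sub continuousOn_const
  -- The shear has no velocity, so `u` is also the velocity of the perturbation and is small with
  -- it.
  have hu : ∀ i, ∀ t ∈ Icc 0 T,
      IsMultiplierImage (velocitySymbol α i) (θ t - shear) (u t i) := by
    intro i t ht k
    rw [coeff_sub, mul_sub, velocitySymbol_mul_coeff_shear, sub_zero]
    exact (hug t ht).1 i k
  have hg : ∀ i, ∀ t ∈ Icc 0 T, IsMultiplierImage (fun k => Complex.I * (k i : ℂ)) (θ t - shear)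
      (g t i - shearGradient i) := fun i t ht => ((hug t ht).2 i).sub (isGradient_shear i)
  have huc : ∀ i, ContinuousOn (fun t => u t i) (Icc 0 T) := fun i =>
    continuousOn_of_isMultiplierImage hb hρc (hu i)
      (exists_symbol_bound hα0 hq (norm_velocitySymbol_sq_le hα0 i))
  have hgc : ∀ i, ContinuousOn (fun t => g t i - shearGradient i) (Icc 0 T) := fun i =>
    continuousOn_of_isMultiplierImage hb hρc (hg i)
      (exists_symbol_bound hα0 hq (norm_gradientSymbol_sq_le hα i))
  have hun : ∀ i, ∀ t ∈ Icc 0 T, ‖u t i‖ ≤ 2 * Real.pi * M := fun i t ht =>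
    (hb t ht).norm_le hM hq.le (hu i t ht) (norm_velocitySymbol_sq_le hα0 i)
  have hgn : ∀ i, ∀ t ∈ Icc 0 T, ‖g t i - shearGradient i‖ ≤ 2 * Real.pi * M := fun i t ht =>
    (hb t ht).norm_le hM hq.le (hg i t ht) (norm_gradientSymbol_sq_le hα i)
  let z : ℤ → ℝ → ℝ := fun j t => (coeff (θ t - shear) ![(n : ℤ), j]).re
  -- The remainder `-u · ∇ρ` at frequency `(n, j)`, quadratic in the perturbation; the shear part of
  -- the gradient supplies the coupling terms.
  let e : ℤ → ℝ → ℝ := fun j t => -((2 * Real.pi)⁻¹ ^ 2 *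
    ∑ i, inner ℝ (u t i) (mulCosine ![(n : ℤ), j] (g t i - shearGradient i)))
  have hz : ∀ j, ∀ t ∈ Icc 0 T, |z j t| ≤ M := fun j t ht =>
    (Complex.abs_re_le_norm _).trans ((hb t ht).norm_coeff_le hM (hα0.trans hq.le) _)
  have hzc : ∀ j, ContinuousOn (z j) (Icc 0 T) := fun j =>
    (Complex.continuous_re.comp (continuous_coeff _)).comp_continuousOn hρc
  have hec : ∀ j, ContinuousOn (e j) (Icc 0 T) := fun j =>
    (continuousOn_const.mul (continuousOn_finsetSum _ fun i _ =>
      ContinuousOn.inner (huc i) ((continuous_mulCosine _).comp_continuousOn (hgc i)))).neg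
  have he : ∀ j, ∀ t ∈ Icc 0 T, |e j t| ≤ 2 * M ^ 2 := by
    intro j t ht
    have h1 : ∀ i, |inner ℝ (u t i) (mulCosine ![(n : ℤ), j] (g t i - shearGradient i))|
        ≤ (2 * Real.pi * M) * (2 * Real.pi * M) := fun i =>
      (abs_inner_mulCosine_le _ _ _).trans
        (mul_le_mul (hun i t ht) (hgn i t ht) (norm_nonneg _) (by positivity))
    simp only [e, abs_neg, abs_mul, Fin.sum_univ_two]
    rw [abs_of_nonneg (by positivity)]
    calc _ ≤ (2 * Real.pi)⁻¹ ^ 2 *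
          ((2 * Real.pi * M) * (2 * Real.pi * M) + (2 * Real.pi * M) * (2 * Real.pi * M)) := by
          gcongr
          exact (abs_add_le _ _).trans (add_le_add (h1 0) (h1 1))
      _ = 2 * M ^ 2 := by field_simp; ring
  have hcu : ∀ j, ∀ t ∈ Icc 0 T, (coeff (u t 1) ![(n : ℤ), j]).re = growthRate α n j * z j t := by
    intro j t ht
    rw [hu 1 t ht, velocitySymbol_one, Complex.re_ofReal_mul]
  have hz0 : ∀ j, (coeff (mode (2 * ε : ℝ) ![(n : ℤ), 0]) ![(n : ℤ), j]).re
      = ε * (if j = 0 then 1 else 0) := by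
    intro j
    have h2 : ![(n : ℤ), j] ≠ -![(n : ℤ), 0] := fun h => by
      have := congrFun h 0
      simp at this
      omega
    rw [coeff_mode, if_neg h2, add_zero]
    by_cases hj : j = 0
    · simp [hj]
    · have h3 : ![(n : ℤ), j] ≠ ![(n : ℤ), 0] := fun h => hj (by simpa using congrFun h 1)
      simp [h3, hj]
  have heq : ∀ j, ∀ t ∈ Icc 0 T, z j t = ε * (if j = 0 then 1 else 0) + ∫ x in (0 : ℝ)..t,
      (growthRate α n (j - 1) * z (j - 1) x + growthRate α n (j + 1) * z (j + 1) x + e j x) := by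
    intro j t ht
    have h1 := hweak (cosine ![(n : ℤ), j]) (smoothOnTorus_cosine _) t ht
    have h2 : ∫ t' in (0 : ℝ)..t, ∫ x : Torus, (∑ i, u t' i x * g t' i x) * cosine ![(n : ℤ), j] x
        = ∫ x in (0 : ℝ)..t, -((2 * Real.pi) ^ 2 * (growthRate α n (j - 1) * z (j - 1) x
          + growthRate α n (j + 1) * z (j + 1) x + e j x)) := by
      refine intervalIntegral.integral_congr fun x hx => ?_
      rw [uIcc_of_le ht.1] at hx
      have hxT : x ∈ Icc 0 T := ⟨hx.1, hx.2.trans ht.2⟩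
      have h3 : ∫ y : Torus, (∑ i, u x i y * g x i y) * cosine ![(n : ℤ), j] y
          = ∑ i, inner ℝ (u x i) (mulCosine ![(n : ℤ), j] (g x i)) := by
        simp only [inner_mulCosine, Finset.sum_mul]
        exact integral_finsetSum _ fun i _ => integrable_mul_mul_cosine _ _ _
      have h4 := inner_mulCosine_shearGradient (u x 1) n j
      rw [hcu _ x hxT, hcu _ x hxT] at h4
      have h5 : mulCosine ![(n : ℤ), j] (shearGradient 0) = 0 := by
        have := mulCosine_sub ![(n : ℤ), j] 0 0
        simpa [shearGradient] using this
      rw [h3]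
      simp only [e, Fin.sum_univ_two, mulCosine_sub, inner_sub_right, h5, inner_zero_right, h4]
      field_simp
      ring
    rw [h2, intervalIntegral.integral_neg, intervalIntegral.integral_const_mul, neg_neg,
      integral_mul_cosine, integral_mul_cosine, ← mul_sub] at h1
    have h6 := mul_left_cancel₀ (by positivity) h1
    rw [coeff_add, Complex.add_re, hz0] at h6
    change (coeff (θ t - shear) _).re = _
    rw [coeff_sub, Complex.sub_re]
    linarith
  have hlow := neighbour_coupling_lower_bound (B := (n : ℝ) ^ 2) (l := (n : ℝ) ^ α / 2) hT
    (by positivity) hε (by positivity) (by positivity) (growthRate_nonneg α n)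
    (growthRate_le hα2 hn) (half_rpow_le_growthRate hα0 hn (by norm_num))
    (half_rpow_le_growthRate hα0 hn (by norm_num)) hz hzc hec he heq
  exact hlow.trans ((le_abs_self _).trans (hz 0 T ⟨hT, le_rfl⟩))

end

section

open MeasureTheory Set Filter Topology

/-! ### Ill-posedness -/

lemma gevreyNorm_shear_lt_top (r s τ : ℝ) : gevreyNorm r s τ shear < ⊤ :=
  (gevreyNorm_mode_le r s τ _ _).trans_lt ENNReal.ofReal_lt_top

/-- Perturbations of the shear flow at high frequency violate every local Lipschitz estimate. -/
theorem locallyLipschitzIllPosed_of_lt {α q r s τ : ℝ} (hα : 1 ≤ α) (hα2 : α ≤ 2) (hq : α < q)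
    (hs : 1 / α < s) (hr : 0 < r) : LocallyLipschitzIllPosed α q r s τ := by
  rintro ⟨T, K, hT, hK, hT0, hK0, H⟩
  have hα0 : 0 < α := by linarith
  have hs0 : 0 < s := (by positivity : 0 < 1 / α).trans hs
  have hsα : 1 / s < α := by
    rw [div_lt_iff₀ hα0] at hs
    rw [div_lt_iff₀ hs0]
    linarith
  set S := (gevreyNorm r s τ shear).toNNReal with hS
  have hSn : gevreyNorm r s τ shear = S :=
    (ENNReal.coe_toNNReal (gevreyNorm_shear_lt_top r s τ).ne).symm
  -- The perturbed data will have Gevrey norm at most `2S + 2`, so compactness fixes a common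
  -- lifespan and Lipschitz constant before `n` and `ε` are chosen.
  obtain ⟨pT, -, hpT⟩ := (isCompact_Icc.prod isCompact_singleton :
    IsCompact (Icc 0 (2 * S + 2) ×ˢ {S} : Set (ℝ≥0 × ℝ≥0))).exists_isMinOn
      ⟨(0, S), ⟨⟨le_rfl, zero_le⟩, rfl⟩⟩ hT.continuousOn
  obtain ⟨pK, -, hpK⟩ := (isCompact_Icc.prod isCompact_singleton :
    IsCompact (Icc 0 (2 * S + 2) ×ˢ {S} : Set (ℝ≥0 × ℝ≥0))).exists_isMaxOn
      ⟨(0, S), ⟨⟨le_rfl, zero_le⟩, rfl⟩⟩ hK.continuousOn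
  have hTp := hT0 pT
  have hKp := hK0 pK
  set T₀ := T pT
  set K₀ := K pK
  -- The `8` is `4 · 2`: the factor `4` in `G`, and `cosh x > exp x / 2`.
  obtain ⟨n, hn, hgap⟩ := exists_nat_mul_rpow_mul_exp_lt (a := 1 / s) (b := α) (c := T₀ / 2)
    (A := 8 * K₀) (r := r) (τ := τ) hsα hα0 (by positivity) (by positivity) hr
  have hn1 : (1 : ℝ) ≤ n := by exact_mod_cast hn
  set G := 4 * ((n : ℝ) ^ r * Real.exp (τ * (n : ℝ) ^ (1 / s))) with hG
  have hG0 : 0 < G := by positivity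
  have hgap' : 0 < Real.cosh ((n : ℝ) ^ α / 2 * T₀) - K₀ * G := by
    have h1 : Real.exp (T₀ / 2 * (n : ℝ) ^ α) / 2 < Real.cosh ((n : ℝ) ^ α / 2 * T₀) := by
      rw [Real.cosh_eq, show (n : ℝ) ^ α / 2 * T₀ = T₀ / 2 * (n : ℝ) ^ α by ring]
      have := Real.exp_pos (-(T₀ / 2 * (n : ℝ) ^ α))
      linarith
    rw [hG]
    linarith
  set g := Real.cosh ((n : ℝ) ^ α / 2 * T₀) - K₀ * G with hg
  set D := 2 * (K₀ * G) ^ 2 * T₀ * Real.exp (2 * (n : ℝ) ^ 2 * T₀) with hD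
  have hD0 : 0 < D := by positivity
  -- The first bound keeps the Gevrey norm of the perturbation at most `1`; the second makes the
  -- quadratic loss `ε² D` at most half of the linear gain `ε g`.
  set ε := min (1 / G) (g / (2 * D)) with hε
  have hε0 : 0 < ε := lt_min (by positivity) (by positivity)
  have hεG : ε * G ≤ 1 := by
    have := min_le_left (1 / G) (g / (2 * D))
    rwa [← hε, le_div_iff₀ hG0] at this
  have hεD : ε * D ≤ g / 2 := by
    have := min_le_right (1 / G) (g / (2 * D))
    rw [← hε, le_div_iff₀ (by positivity)] at this
    linarith
  set P : L2 := mode (2 * ε : ℝ) ![(n : ℤ), 0] with hP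
  have hne : (![(n : ℤ), 0] : Fin 2 → ℤ) ≠ 0 := fun h => by
    have := congrFun h 0
    simp at this
    omega
  have hfreq : freqNorm ![(n : ℤ), 0] = n := by simp [freqNorm]
  have hPG : gevreyNorm r s τ P ≤ ENNReal.ofReal (ε * G) := by
    refine (gevreyNorm_mode_le r s τ _ _).trans (ENNReal.ofReal_le_ofReal (le_of_eq ?_))
    rw [hfreq, Complex.norm_real, Real.norm_of_nonneg (by positivity), hG]
    ring
  have hmean : MeanFree (shear + P) := by
    refine meanFree_of_coeff_zero ?_
    rw [coeff_add, hP, shear, coeff_mode_of_ne freq_ne_zero.symm (neg_ne_zero.mpr freq_ne_zero).symm,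
      coeff_mode_of_ne hne.symm (neg_ne_zero.mpr hne).symm, add_zero]
  have hsum : gevreyNorm r s τ (shear + P) ≤ ((2 * S + 2 : ℝ≥0) : ℝ≥0∞) := by
    refine (gevreyNorm_add_le r s τ shear P).trans ?_
    have h1 : gevreyNorm r s τ P ≤ 1 :=
      hPG.trans ((ENNReal.ofReal_le_ofReal hεG).trans ENNReal.ofReal_one.le)
    rw [hSn]
    push_cast
    gcongr
    exact (mul_le_mul_right h1 2).trans (mul_one _).le
  obtain ⟨θ₁, θ₂, h1, h2, hLip⟩ := H (shear + P) shear
    ⟨hmean, hsum.trans_lt ENNReal.coe_lt_top⟩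
    ⟨meanFree_mode _ freq_ne_zero, gevreyNorm_shear_lt_top r s τ⟩
  set p : ℝ≥0 × ℝ≥0 := ((gevreyNorm r s τ (shear + P)).toNNReal, (gevreyNorm r s τ shear).toNNReal)
  have hp : p ∈ (Icc 0 (2 * S + 2) ×ˢ {S} : Set (ℝ≥0 × ℝ≥0)) :=
    ⟨⟨zero_le, ENNReal.toNNReal_mono ENNReal.coe_ne_top hsum⟩, rfl⟩
  have hT₀ : T₀ ≤ T p := hpT hp
  have hK₀ : K p ≤ K₀ := hpK hp
  have hb : ∀ t ∈ Icc 0 T₀, SobolevBound q (θ₁ t - shear) (K₀ * G * ε) := by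
    intro t ht
    have htp : t ∈ Icc 0 (T p) := ⟨ht.1, ht.2.trans hT₀⟩
    have h3 := hLip t htp
    -- Uniqueness identifies the second solution with the stationary shear.
    rw [← h2.2 _ (isSolution_shear α q (T p)) htp, add_sub_cancel_left] at h3
    refine sobolevBound_of_sobolevNorm_le (by positivity) (h3.trans ?_)
    rw [show K₀ * G * ε = K₀ * (ε * G) by ring, ENNReal.ofReal_mul hKp.le]
    exact mul_le_mul' (ENNReal.ofReal_le_ofReal hK₀) hPG
  have hfin := (h1.1.mono hT₀).growth hα hα2 hq hTp.le (by positivity) hε0.le hn hb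
  -- The growth estimate with `M = K₀ G ε`, rearranged; dividing by `ε` gives `g ≤ ε D ≤ g / 2`,
  -- impossible for `g > 0`.
  have h4 : ε * g ≤ ε * (ε * D) := by
    rw [hg, hD]
    linarith
  have h5 := le_of_mul_le_mul_left h4 hε0
  linarith

end

end SIPM

end

theorem mainTheorem6 (α q r s τ : ℝ) (hα : 1 ≤ α ∧ α < 2) (hq : α + 1 / 2 < q)
    (hs : 1 / α < s) (hr : 3 < r) (hτ : 0 < τ) :
    SIPM.LocallyLipschitzIllPosed α q r s τ :=
  SIPM.locallyLipschitzIllPosed_of_lt hα.1 hα.2.le (by linarith) hs (by linarith)
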